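/- Let $n\ge 0$ be an integer and let $\nu$ be a $\sigma$-finite (or, more generally, $s$-finite, i.e. a countable sum of finite measures) Borel measure on $\mathbb{R}^n$, with values in $[0,\infty]$, that is rotation invariant: $\nu(U(A))=\nu(A)$ for every Borel set $A\subseteq\mathbb{R}^n$ and every $U$ in the group $O(n)$ of real orthogonal $n\times n$ matrices. Let $r_1,\dots,r_n>0$ and $\rho_1,\dots,\rho_n>0$, and let $$E=\Big\{x\in\mathbb{R}^n:\sum_{i=1}^n \frac{x_i^2}{r_i^2}\le 1\Big\},\qquad F=\Big\{x\in\mathbb{R}^n:\sum_{i=1}^n \frac{x_i^2}{\rho_i^2}\le 1\Big\}$$ be two ellipsoids in standard position. Then the minimum $\min\{\nu(U(F)\cap E): U\in O(n)\}$ exists and is attained at some row permutation of the identity: there is a permutation $\sigma$ of $\{1,\dots,n\}$ such that the matrix $P\in O(n)$ whose $i$-th row is the $\sigma(i)$-th row of the identity matrix satisfies $$\nu(P(F)\cap E)=\min_{U\in O(n)}\nu(U(F)\cap E).$$ In particular $P(F)=\big\{x\in\mathbb{R}^n:\sum_{i=1}^n x_i^2/\rho_{\sigma(i)}^2\le 1\big\}$,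 so $P(F)$ and $E$ are ellipsoids with the same axes. -/

import Mathlib

open MeasureTheory

/-- The linear map `x ↦ M x` of Euclidean space `ℝⁿ` given by a real `n × n` matrix `M`. -/
noncomputable def matAct {n : ℕ} (M : Matrix (Fin n) (Fin n) ℝ)
    (x : EuclideanSpace ℝ (Fin n)) : EuclideanSpace ℝ (Fin n) :=
  WithLp.toLp 2 (M.mulVec x.ofLp)

/-- A measure on `ℝⁿ` is rotation invariant if every orthogonal matrix maps it to itself. -/
def IsRotationInvariant {n : ℕ} (ν : Measure (EuclideanSpace ℝ (Fin n))) : Prop :=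
  ∀ U ∈ Matrix.orthogonalGroup (Fin n) ℝ, Measure.map (matAct U) ν = ν

/-- The ellipsoid in standard position with semi-axes `r i` along the coordinate axes:
all `x` with `∑ x_i² / r_i² ≤ 1`. It is used for positive `r i` only. -/
def stdEllipsoid {n : ℕ} (r : Fin n → ℝ) : Set (EuclideanSpace ℝ (Fin n)) :=
  {x | ∑ i, x i ^ 2 / r i ^ 2 ≤ 1}

/-- The identity matrix with its rows permuted: row `i` is row `σ i` of the identity. -/
def rowPerm {n : ℕ} (σ : Equiv.Perm (Fin n)) : Matrix (Fin n) (Fin n) ℝ :=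
  (1 : Matrix (Fin n) (Fin n) ℝ).submatrix σ id

/-!
The overlap of two ellipsoids under a rotation `U` is smallest when their axes coincide. Write the
ellipsoids as `{diagForm a (U x) ≤ 1}` and `{diagForm b x ≤ 1}` and replace the indicator function
of `[0, 1]` by a smooth strictly decreasing function `smoothStep m`. The smoothed overlap is
`∫ smoothStep m (diagForm a (U x)) * smoothStep m (diagForm b x) dν(x)`.

Suppose that `ν` is finite with full support and the entries of `b` are distinct. By compactness
some `U` minimises the smoothed overlap; put `A = Uᵀ (diagonal a) U`. If row `i` of `A` had a
nonzero off-diagonal entry, let `y x = x i * ∑ j ≠ i, A i j * x j`. As the entries of `b` are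
distinct, there is a skew-symmetric `K` along which `diagForm b` varies at rate `2 * y`
(`exists_skew_bilin_eq`), so the integral of
`smoothStep m (diagForm a (U x)) * (smoothStep m)' (diagForm b x) * 2 * y x` vanishes. The
reflection `x i ↦ -x i` preserves `ν` and `diagForm b`, negates `y`, and changes `diagForm a (U x)`
by `4 * y x`; as `smoothStep m` is decreasing, averaging the integrand over this reflection makes
it nonnegative and somewhere positive, a contradiction (`conj_apply_eq_zero_of_isMin`). Hence `A`
is diagonal, and comparing characteristic polynomials shows that `U` may be replaced by a
permutation matrix.

The extra assumptions are removed by limits: perturb `b`, add a small multiple of the standard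
Gaussian to `ν`, let `m → ∞`, and write an s-finite `ν` as a sum of finite invariant measures by
averaging over the orthogonal group (`IsRotationInvariant.exists_eq_sum`). The minimising
permutation may vary along the way, but there are only finitely many, so one of them occurs
frequently and survives in the limit (`exists_le_of_tendsto`).
-/

open Filter Topology Matrix

/-! ### Matrices acting on Euclidean space -/

lemma matAct_apply {n : ℕ} (M : Matrix (Fin n) (Fin n) ℝ) (x : EuclideanSpace ℝ (Fin n))
    (i : Fin n) : matAct M x i = ∑ j, M i j * x j := rfl

lemma matAct_mul {n : ℕ} (M N : Matrix (Fin n) (Fin n) ℝ) (x : EuclideanSpace ℝ (Fin n)) :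
    matAct (M * N) x = matAct M (matAct N x) := by
  simp [matAct, Matrix.mulVec_mulVec]

lemma matAct_one {n : ℕ} (x : EuclideanSpace ℝ (Fin n)) :
    matAct (1 : Matrix (Fin n) (Fin n) ℝ) x = x := by
  simp [matAct]

lemma continuous_matAct_uncurry {n : ℕ} :
    Continuous fun p : Matrix (Fin n) (Fin n) ℝ × EuclideanSpace ℝ (Fin n) => matAct p.1 p.2 := by
  unfold matAct
  fun_prop

lemma continuous_matAct {n : ℕ} (M : Matrix (Fin n) (Fin n) ℝ) : Continuous (matAct M) :=
  continuous_matAct_uncurry.comp (Continuous.prodMk_right M)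

lemma continuous_matAct_left {n : ℕ} (x : EuclideanSpace ℝ (Fin n)) :
    Continuous fun M : Matrix (Fin n) (Fin n) ℝ => matAct M x :=
  continuous_matAct_uncurry.comp (Continuous.prodMk_left x)

lemma matAct_transpose_matAct {n : ℕ} {U : Matrix (Fin n) (Fin n) ℝ}
    (hU : U ∈ orthogonalGroup (Fin n) ℝ) (x : EuclideanSpace ℝ (Fin n)) :
    matAct Uᵀ (matAct U x) = x := by
  rw [← matAct_mul, (mem_orthogonalGroup_iff' _ _).1 hU, matAct_one]

lemma matAct_matAct_transpose {n : ℕ} {U : Matrix (Fin n) (Fin n) ℝ}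
    (hU : U ∈ orthogonalGroup (Fin n) ℝ) (x : EuclideanSpace ℝ (Fin n)) :
    matAct U (matAct Uᵀ x) = x := by
  rw [← matAct_mul, (mem_orthogonalGroup_iff _ _).1 hU, matAct_one]

lemma transpose_mem_orthogonalGroup {n : ℕ} {U : Matrix (Fin n) (Fin n) ℝ}
    (hU : U ∈ orthogonalGroup (Fin n) ℝ) : Uᵀ ∈ orthogonalGroup (Fin n) ℝ := by
  rw [mem_orthogonalGroup_iff, transpose_transpose]
  exact (mem_orthogonalGroup_iff' _ _).1 hU

lemma isCompact_orthogonalGroup (n : ℕ) :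
    IsCompact (orthogonalGroup (Fin n) ℝ : Set (Matrix (Fin n) (Fin n) ℝ)) := by
  have hK : IsCompact (Set.univ.pi fun _ : Fin n => Set.univ.pi fun _ : Fin n =>
      Set.Icc (-1 : ℝ) 1) :=
    isCompact_univ_pi fun _ => isCompact_univ_pi fun _ => isCompact_Icc
  have hclosed : IsClosed (orthogonalGroup (Fin n) ℝ : Set (Matrix (Fin n) (Fin n) ℝ)) := by
    have : (orthogonalGroup (Fin n) ℝ : Set (Matrix (Fin n) (Fin n) ℝ)) = {U | U * Uᵀ = 1} := by
      ext U
      exact mem_orthogonalGroup_iff _ _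
    rw [this]
    exact isClosed_eq (by fun_prop) continuous_const
  refine hK.of_isClosed_subset hclosed fun U hU i _ j _ => ?_
  have h := entry_norm_bound_of_unitary hU i j
  rw [Real.norm_eq_abs, abs_le] at h
  exact h

lemma rowPerm_mem_orthogonalGroup {n : ℕ} (σ : Equiv.Perm (Fin n)) :
    rowPerm σ ∈ orthogonalGroup (Fin n) ℝ := by
  rw [mem_orthogonalGroup_iff]
  ext i j
  simp [rowPerm, mul_apply, one_apply]

lemma matAct_rowPerm_apply {n : ℕ} (σ : Equiv.Perm (Fin n)) (x : EuclideanSpace ℝ (Fin n))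
    (i : Fin n) : matAct (rowPerm σ) x i = x (σ i) := by
  simp [matAct_apply, rowPerm, one_apply]

lemma IsRotationInvariant.integral_comp {n : ℕ} {ν : Measure (EuclideanSpace ℝ (Fin n))}
    (hν : IsRotationInvariant ν) {U : Matrix (Fin n) (Fin n) ℝ}
    (hU : U ∈ orthogonalGroup (Fin n) ℝ) {g : EuclideanSpace ℝ (Fin n) → ℝ} (hg : Continuous g) :
    ∫ x, g (matAct U x) ∂ν = ∫ x, g x ∂ν := by
  conv_rhs => rw [← hν U hU]
  rw [integral_map (continuous_matAct U).aemeasurable hg.aestronglyMeasurable]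

/-! ### Diagonal quadratic forms -/

/-- The quadratic form `x ↦ ∑ i, a i * x i ^ 2` with diagonal matrix `a`. -/
def diagForm {n : ℕ} (a : Fin n → ℝ) (x : EuclideanSpace ℝ (Fin n)) : ℝ :=
  ∑ i, a i * x i ^ 2

lemma continuous_diagForm {n : ℕ} (a : Fin n → ℝ) : Continuous (diagForm a) := by
  unfold diagForm
  fun_prop

lemma diagForm_nonneg {n : ℕ} {a : Fin n → ℝ} (ha : ∀ i, 0 < a i)
    (x : EuclideanSpace ℝ (Fin n)) : 0 ≤ diagForm a x :=
  Finset.sum_nonneg fun i _ => mul_nonneg (ha i).le (sq_nonneg _)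

lemma mul_sq_le_diagForm {n : ℕ} {a : Fin n → ℝ} (ha : ∀ i, 0 < a i)
    (x : EuclideanSpace ℝ (Fin n)) (i : Fin n) : a i * x i ^ 2 ≤ diagForm a x :=
  Finset.single_le_sum (f := fun i => a i * x i ^ 2)
    (fun i _ => mul_nonneg (ha i).le (sq_nonneg _)) (Finset.mem_univ i)

/-! ### A smooth approximation of the indicator function of `[0, 1]` -/

/-- A smooth decreasing function on `ℝ`; on `[0, ∞)` these functions take values in `[0, 1]` and
tend pointwise to the indicator function of `[0, 1]` as `m → ∞`. The exponent is odd so that the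
function is strictly decreasing on all of `ℝ`. -/
noncomputable def smoothStep (m : ℕ) (u : ℝ) : ℝ :=
  Real.exp (-(u ^ (2 * m + 1) / (2 * m + 1)))

lemma hasDerivAt_smoothStep (m : ℕ) (u : ℝ) :
    HasDerivAt (smoothStep m) (-(u ^ (2 * m) * smoothStep m u)) u := by
  have h := (((hasDerivAt_pow (2 * m + 1) u).div_const (2 * m + 1 : ℝ)).neg).exp
  refine h.congr_deriv ?_
  have : (2 * m + 1 : ℝ) ≠ 0 := by positivity
  simp only [smoothStep, Pi.neg_apply]
  push_cast
  field_simp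

lemma continuous_smoothStep (m : ℕ) : Continuous (smoothStep m) := by
  unfold smoothStep
  fun_prop

lemma smoothStep_pos (m : ℕ) (u : ℝ) : 0 < smoothStep m u := Real.exp_pos _

lemma smoothStep_le_one (m : ℕ) {u : ℝ} (hu : 0 ≤ u) : smoothStep m u ≤ 1 := by
  rw [smoothStep, Real.exp_le_one_iff]
  have : 0 ≤ u ^ (2 * m + 1) / (2 * m + 1 : ℝ) := by positivity
  linarith

lemma strictAnti_smoothStep (m : ℕ) : StrictAnti (smoothStep m) := by
  intro u v huv
  have h : u ^ (2 * m + 1) < v ^ (2 * m + 1) := (odd_two_mul_add_one m).strictMono_pow huv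
  unfold smoothStep
  gcongr

lemma mul_pow_mul_smoothStep_le (m : ℕ) {u : ℝ} :
    u * (u ^ (2 * m) * smoothStep m u) ≤ 2 * m + 1 := by
  have hk : (0 : ℝ) < 2 * m + 1 := by positivity
  set t := u ^ (2 * m + 1) / (2 * m + 1 : ℝ) with ht
  have h1 : u * (u ^ (2 * m) * smoothStep m u) = (2 * m + 1) * (t * Real.exp (-t)) := by
    rw [smoothStep, ← ht, ht]
    field_simp
    ring
  have h2 : t * Real.exp (-t) ≤ 1 := by
    rw [Real.exp_neg, ← div_eq_mul_inv, div_le_one (Real.exp_pos t)]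
    linarith [Real.add_one_le_exp t]
  rw [h1]
  nlinarith

lemma tendsto_smoothStep {u : ℝ} (hu : 0 ≤ u) :
    Tendsto (fun m => smoothStep m u) atTop (𝓝 (Set.indicator (Set.Iic 1) 1 u)) := by
  have hodd : Tendsto (fun m : ℕ => 2 * m + 1) atTop atTop :=
    tendsto_atTop_mono (fun m => by simp only [id]; omega) tendsto_id
  have hlin : Tendsto (fun m : ℕ => (2 * m + 1 : ℝ)) atTop atTop := by
    have := tendsto_natCast_atTop_atTop (R := ℝ) |>.comp hodd
    refine this.congr fun m => by simp
  by_cases h : u ≤ 1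
  · rw [Set.indicator_of_mem (by simpa using h)]
    have h0 : Tendsto (fun m : ℕ => u ^ (2 * m + 1) / (2 * m + 1 : ℝ)) atTop (𝓝 0) := by
      refine squeeze_zero (fun m => by positivity) (fun m => ?_) hlin.inv_tendsto_atTop
      rw [Pi.inv_apply, ← one_div]
      gcongr
      exact pow_le_one₀ hu h
    simpa [smoothStep] using (h0.neg).rexp
  · rw [Set.indicator_of_notMem (by simpa using h)]
    push Not at h
    have h0 : Tendsto (fun m : ℕ => (2 * m + 1 : ℝ) / u ^ (2 * m + 1)) atTop (𝓝 0) := by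
      have := (tendsto_pow_const_div_const_pow_of_one_lt 1 h).comp hodd
      refine this.congr fun m => by simp
    have h1 : Tendsto (fun m : ℕ => u ^ (2 * m + 1) / (2 * m + 1 : ℝ)) atTop atTop := by
      have h2 : Tendsto (fun m : ℕ => (2 * m + 1 : ℝ) / u ^ (2 * m + 1)) atTop (𝓝[>] 0) :=
        tendsto_nhdsWithin_iff.2 ⟨h0, Eventually.of_forall fun m => by
          have : 0 < u := by linarith
          simp only [Set.mem_Ioi]; positivity⟩
      refine h2.inv_tendsto_nhdsGT_zero.congr fun m => by simp
    exact Real.tendsto_exp_neg_atTop_nhds_zero.comp h1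

/-! ### The smoothed overlap -/

/-- The smoothed overlap of two centred ellipsoids, one of them rotated by `U`: as `m → ∞`, the
integrand tends to the indicator function of `{x | diagForm a (U x) ≤ 1 ∧ diagForm b x ≤ 1}`. -/
noncomputable def overlap {n : ℕ} (m : ℕ) (ν : Measure (EuclideanSpace ℝ (Fin n)))
    (a b : Fin n → ℝ) (U : Matrix (Fin n) (Fin n) ℝ) : ℝ :=
  ∫ x, smoothStep m (diagForm a (matAct U x)) * smoothStep m (diagForm b x) ∂ν

lemma norm_smoothStep_mul_le {n : ℕ} (m : ℕ) {a b : Fin n → ℝ} (ha : ∀ i, 0 < a i)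
    (hb : ∀ i, 0 < b i) (x y : EuclideanSpace ℝ (Fin n)) :
    ‖smoothStep m (diagForm a x) * smoothStep m (diagForm b y)‖ ≤ 1 := by
  rw [Real.norm_of_nonneg (mul_pos (smoothStep_pos _ _) (smoothStep_pos _ _)).le]
  exact mul_le_one₀ (smoothStep_le_one m (diagForm_nonneg ha x)) (smoothStep_pos _ _).le
    (smoothStep_le_one m (diagForm_nonneg hb y))

lemma continuous_overlap_integrand {n : ℕ} (m : ℕ) (a b : Fin n → ℝ)
    (U V : Matrix (Fin n) (Fin n) ℝ) :
    Continuous fun x : EuclideanSpace ℝ (Fin n) =>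
      smoothStep m (diagForm a (matAct U x)) * smoothStep m (diagForm b (matAct V x)) :=
  ((continuous_smoothStep m).comp ((continuous_diagForm a).comp (continuous_matAct U))).mul
    ((continuous_smoothStep m).comp ((continuous_diagForm b).comp (continuous_matAct V)))

lemma continuous_overlap_integrand_id {n : ℕ} (m : ℕ) (a b : Fin n → ℝ)
    (U : Matrix (Fin n) (Fin n) ℝ) :
    Continuous fun x : EuclideanSpace ℝ (Fin n) =>
      smoothStep m (diagForm a (matAct U x)) * smoothStep m (diagForm b x) := by
  simpa [matAct_one] using continuous_overlap_integrand m a b U 1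

lemma integrable_overlap_integrand {n : ℕ} (m : ℕ) (ν : Measure (EuclideanSpace ℝ (Fin n)))
    [IsFiniteMeasure ν] {a b : Fin n → ℝ} (ha : ∀ i, 0 < a i) (hb : ∀ i, 0 < b i)
    (U : Matrix (Fin n) (Fin n) ℝ) :
    Integrable (fun x => smoothStep m (diagForm a (matAct U x)) * smoothStep m (diagForm b x)) ν :=
  Integrable.of_bound (continuous_overlap_integrand_id m a b U).aestronglyMeasurable 1
    (Eventually.of_forall fun _ => norm_smoothStep_mul_le m ha hb _ _)

lemma continuous_overlap {n : ℕ} (m : ℕ) (ν : Measure (EuclideanSpace ℝ (Fin n)))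
    [IsFiniteMeasure ν] {a b : Fin n → ℝ} (ha : ∀ i, 0 < a i) (hb : ∀ i, 0 < b i) :
    Continuous (overlap m ν a b) := by
  have : FirstCountableTopology (Matrix (Fin n) (Fin n) ℝ) :=
    inferInstanceAs (FirstCountableTopology (Fin n → Fin n → ℝ))
  refine continuous_of_dominated (bound := fun _ => 1)
    (fun U => (continuous_overlap_integrand_id m a b U).aestronglyMeasurable)
    (fun U => Eventually.of_forall fun x => norm_smoothStep_mul_le m ha hb _ _)
    (integrable_const _) (Eventually.of_forall fun x => ?_)
  exact ((continuous_smoothStep m).comp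
    ((continuous_diagForm a).comp (continuous_matAct_left x))).mul continuous_const

/-! ### Permutations from conjugate diagonal matrices, and limits of minimisers -/

/-- If a diagonal matrix is orthogonally conjugate to the diagonal matrix `a`, then its entries are
a permutation of those of `a`. -/
lemma exists_perm_of_conj_diagonal {n : ℕ} {a d : Fin n → ℝ} {U : Matrix (Fin n) (Fin n) ℝ}
    (hU : U ∈ orthogonalGroup (Fin n) ℝ) (h : Uᵀ * diagonal a * U = diagonal d) :
    ∃ σ : Equiv.Perm (Fin n), ∀ i, a (σ i) = d i := by
  have hchar : (diagonal d).charpoly = (diagonal a).charpoly := by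
    rw [← h, Matrix.mul_assoc, charpoly_mul_comm, Matrix.mul_assoc,
      (mem_orthogonalGroup_iff _ _).1 hU, Matrix.mul_one]
  have hroots : Finset.univ.val.map d = Finset.univ.val.map a := by
    have := congrArg Polynomial.roots hchar
    simpa [charpoly_diagonal, Polynomial.roots_prod, Finset.prod_ne_zero_iff,
      Polynomial.X_sub_C_ne_zero, Multiset.bind_singleton] using this
  have hcard : ∀ c, Fintype.card {i // d i = c} = Fintype.card {i // a i = c} := by
    intro c
    have := congrArg (Multiset.count c) hroots
    simp only [Multiset.count_map] at this
    rw [Fintype.card_subtype, Fintype.card_subtype]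
    simpa [Finset.card_def, Finset.filter_val, eq_comm] using this
  exact ⟨Equiv.ofFiberEquiv fun c => Fintype.equivOfCardEq (hcard c),
    Equiv.ofFiberEquiv_map _⟩

/-- A limit of functions each of which is minimised at one of finitely many points is itself
minimised at one of these points. -/
lemma exists_le_of_tendsto {ι X κ T : Type*} [Finite κ] [TopologicalSpace T] [Preorder T]
    [OrderClosedTopology T] {l : Filter ι} [NeBot l] {p : κ → X} {S : Set X} {F : ι → X → T}
    {G : X → T} (hF : ∀ᶠ i in l, ∃ σ, ∀ U ∈ S, F i (p σ) ≤ F i U)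
    (hlim : ∀ U, Tendsto (F · U) l (𝓝 (G U))) : ∃ σ, ∀ U ∈ S, G (p σ) ≤ G U := by
  have hfreq : ∃ σ, ∃ᶠ i in l, ∀ U ∈ S, F i (p σ) ≤ F i U := by
    by_contra h
    simp only [not_exists, not_frequently] at h
    obtain ⟨i, ⟨σ, hσ⟩, hi⟩ := (hF.and (eventually_all.2 h)).exists
    exact hi σ hσ
  obtain ⟨σ, hσ⟩ := hfreq
  exact ⟨σ, fun U hU => le_of_tendsto_of_tendsto_of_frequently (hlim _) (hlim _)
    (hσ.mono fun i hi => hi U hU)⟩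

/-! ### Coordinate reflections -/

/-- Flipping the sign of `x i` changes only the terms of the form `Uᵀ (diagonal a) U` which mix
`x i` with the other coordinates. -/
lemma diagForm_matAct_sub_diagForm_matAct_sign {n : ℕ} (a : Fin n → ℝ)
    (U : Matrix (Fin n) (Fin n) ℝ) (i : Fin n) (x : EuclideanSpace ℝ (Fin n)) :
    diagForm a (matAct U x) -
      diagForm a (matAct U (matAct (diagonal fun j => if j = i then (-1 : ℝ) else 1) x)) =
    4 * (x i * ∑ j, (if j = i then 0 else (Uᵀ * diagonal a * U) i j) * x j) := by
  set R := diagonal fun j => if j = i then (-1 : ℝ) else 1 with hR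
  have hcoord : ∀ p, matAct U (matAct R x) p = matAct U x p - 2 * x i * U p i := by
    intro p
    have hterm : ∀ j, U p j * (R *ᵥ x.ofLp) j =
        U p j * x j - (if j = i then 2 * x i * U p i else 0) := by
      intro j
      rw [hR, mulVec_diagonal]
      split_ifs with h
      · subst h; ring
      · ring
    calc matAct U (matAct R x) p = ∑ j, U p j * (R *ᵥ x.ofLp) j := rfl
      _ = _ := by simp_rw [hterm, Finset.sum_sub_distrib, matAct_apply]; simp
  have hrow : ∀ j, (Uᵀ * diagonal a * U) i j = ∑ p, a p * U p i * U p j := by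
    intro j
    rw [Matrix.mul_apply]
    exact Finset.sum_congr rfl fun p _ => by rw [mul_diagonal, transpose_apply]; ring
  have hoff : ∑ j, (if j = i then 0 else (Uᵀ * diagonal a * U) i j) * x j =
      ∑ p, a p * U p i * (matAct U x p - x i * U p i) := by
    have h1 : ∀ j, (if j = i then 0 else (Uᵀ * diagonal a * U) i j) * x j =
        (∑ p, a p * U p i * U p j) * x j -
          (if j = i then (∑ p, a p * U p i * U p i) * x i else 0) := by
      intro j
      rw [hrow]
      split_ifs with h
      · subst h; ring
      · ring
    simp_rw [h1, Finset.sum_sub_distrib, Finset.sum_mul, matAct_apply, mul_sub,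
      Finset.sum_sub_distrib, Finset.mul_sum]
    rw [Finset.sum_comm]
    simp only [Finset.sum_ite_eq', Finset.mem_univ, if_true]
    congr 1
    · exact Finset.sum_congr rfl fun p _ => Finset.sum_congr rfl fun j _ => by ring
    · exact Finset.sum_congr rfl fun p _ => by ring
  rw [hoff, diagForm, diagForm, ← Finset.sum_sub_distrib, Finset.mul_sum, Finset.mul_sum]
  refine Finset.sum_congr rfl fun p _ => ?_
  rw [hcoord]
  ring

lemma diagForm_matAct_sign {n : ℕ} (b : Fin n → ℝ) (i : Fin n) (x : EuclideanSpace ℝ (Fin n)) :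
    diagForm b (matAct (diagonal fun j => if j = i then (-1 : ℝ) else 1) x) = diagForm b x := by
  refine Finset.sum_congr rfl fun j _ => ?_
  change b j * ((diagonal fun j => if j = i then (-1 : ℝ) else 1) *ᵥ x.ofLp) j ^ 2 = _
  rw [mulVec_diagonal]
  split_ifs <;> ring

lemma diagonal_sign_mem_orthogonalGroup {n : ℕ} (i : Fin n) :
    diagonal (fun j => if j = i then (-1 : ℝ) else 1) ∈ orthogonalGroup (Fin n) ℝ := by
  rw [mem_orthogonalGroup_iff, diagonal_transpose, diagonal_mul_diagonal, ← diagonal_one]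
  congr 1
  ext j
  split_ifs <;> simp

/-! ### One-parameter groups of rotations -/

lemma exp_smul_mem_orthogonalGroup {n : ℕ} {K : Matrix (Fin n) (Fin n) ℝ} (hK : Kᵀ = -K) (s : ℝ) :
    NormedSpace.exp (s • K) ∈ orthogonalGroup (Fin n) ℝ := by
  rw [mem_orthogonalGroup_iff, ← exp_transpose, transpose_smul, hK,
    ← Matrix.exp_add_of_commute _ _ ((Commute.refl K).neg_right.smul_left s |>.smul_right s)]
  simp

open scoped Matrix.Norms.Operator in
lemma hasDerivAt_matAct_exp {n : ℕ} (K : Matrix (Fin n) (Fin n) ℝ) (x : EuclideanSpace ℝ (Fin n))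
    (i : Fin n) (s : ℝ) :
    HasDerivAt (fun s : ℝ => matAct (NormedSpace.exp (s • K)) x i)
      (matAct K (matAct (NormedSpace.exp (s • K)) x) i) s := by
  have h := hasDerivAt_exp_smul_const' (𝕂 := ℝ) K s
  let φ : Matrix (Fin n) (Fin n) ℝ →ₗ[ℝ] ℝ :=
    { toFun := fun M => matAct M x i
      map_add' := fun M N => by simp [matAct_apply, add_mul, Finset.sum_add_distrib]
      map_smul' := fun c M => by simp [matAct_apply, Finset.mul_sum, mul_assoc] }
  have h2 := (LinearMap.toContinuousLinearMap φ).hasFDerivAt.comp_hasDerivAt s h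
  rw [← matAct_mul]
  exact h2

lemma hasDerivAt_diagForm_exp {n : ℕ} (b : Fin n → ℝ) (K : Matrix (Fin n) (Fin n) ℝ)
    (x : EuclideanSpace ℝ (Fin n)) (s : ℝ) :
    HasDerivAt (fun s : ℝ => diagForm b (matAct (NormedSpace.exp (s • K)) x))
      (2 * ∑ p, b p * (matAct (NormedSpace.exp (s • K)) x p *
        matAct K (matAct (NormedSpace.exp (s • K)) x) p)) s := by
  have h := HasDerivAt.fun_sum (u := Finset.univ) fun p _ =>
    ((hasDerivAt_matAct_exp K x p s).pow 2).const_mul (b p)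
  refine h.congr_deriv ?_
  rw [Finset.mul_sum]
  exact Finset.sum_congr rfl fun p _ => by simp; ring

/-- A bound which makes the derivative of the smoothed overlap integrable uniformly along a
one-parameter group of rotations. -/
lemma exists_abs_le_mul_diagForm {n : ℕ} {b : Fin n → ℝ} (hb : ∀ i, 0 < b i)
    (c : Fin n → ℝ) (i : Fin n) :
    ∃ C, ∀ x : EuclideanSpace ℝ (Fin n), |x i * ∑ j, c j * x j| ≤ C * diagForm b x := by
  refine ⟨∑ j, |c j| * (1 / b i + 1 / b j), fun x => ?_⟩
  rw [Finset.mul_sum, Finset.sum_mul]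
  refine (Finset.abs_sum_le_sum_abs _ _).trans (Finset.sum_le_sum fun j _ => ?_)
  have hsq : ∀ k, x k ^ 2 ≤ 1 / b k * diagForm b x := by
    intro k
    rw [one_div, ← div_eq_inv_mul, le_div_iff₀ (hb k), mul_comm]
    exact mul_sq_le_diagForm hb x k
  have hxy : |x i| * |x j| ≤ x i ^ 2 + x j ^ 2 := by
    nlinarith [sq_nonneg (|x i| - |x j|), sq_abs (x i), sq_abs (x j), abs_nonneg (x i),
      abs_nonneg (x j), mul_nonneg (abs_nonneg (x i)) (abs_nonneg (x j))]
  calc |x i * (c j * x j)| = |c j| * (|x i| * |x j|) := by rw [abs_mul, abs_mul]; ring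
    _ ≤ |c j| * ((1 / b i + 1 / b j) * diagForm b x) := by
        refine mul_le_mul_of_nonneg_left ?_ (abs_nonneg _)
        linarith [hsq i, hsq j]
    _ = _ := by ring

/-- A skew-symmetric matrix with `xᵀ (diagonal b) K x = x i * ∑ j, c j * x j`. It exists because the
entries of `b` are distinct. -/
lemma exists_skew_bilin_eq {n : ℕ} {b : Fin n → ℝ} (hb : Function.Injective b) {c : Fin n → ℝ}
    {i : Fin n} (hc : c i = 0) :
    ∃ K : Matrix (Fin n) (Fin n) ℝ, Kᵀ = -K ∧ ∀ x : EuclideanSpace ℝ (Fin n),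
      ∑ p, b p * (x p * matAct K x p) = x i * ∑ j, c j * x j := by
  set k : Fin n → ℝ := fun j => c j / (b i - b j) with hk
  have hkc : ∀ j, (b i - b j) * k j = c j := by
    intro j
    rcases eq_or_ne j i with rfl | h
    · simp [hc]
    · have : b i - b j ≠ 0 := sub_ne_zero.2 fun e => h (hb e).symm
      rw [hk]
      field_simp
  refine ⟨vecMulVec (Pi.single i 1) k - vecMulVec k (Pi.single i 1), ?_, fun x => ?_⟩
  · rw [transpose_sub, transpose_vecMulVec, transpose_vecMulVec, neg_sub]
  have hK : ∀ p, matAct (vecMulVec (Pi.single i 1) k - vecMulVec k (Pi.single i 1)) x p =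
      (if p = i then ∑ j, k j * x j else 0) - k p * x i := by
    intro p
    simp only [matAct_apply, Matrix.sub_apply, vecMulVec_apply, sub_mul, Finset.sum_sub_distrib,
      Pi.single_apply]
    congr 1
    · split_ifs <;> simp
    · simp
  have hterm : ∀ p, b p * (x p * matAct (vecMulVec (Pi.single i 1) k -
      vecMulVec k (Pi.single i 1)) x p) =
      (if p = i then b i * x i * ∑ j, k j * x j else 0) - x i * (b p * k p * x p) := by
    intro p
    rw [hK]
    split_ifs with h
    · subst h; ring
    · ring
  simp_rw [hterm, Finset.sum_sub_distrib, Finset.sum_ite_eq', Finset.mem_univ, if_true,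
    Finset.mul_sum, ← Finset.sum_sub_distrib]
  refine Finset.sum_congr rfl fun j _ => ?_
  rw [← hkc j]
  ring

/-- The derivative of the smoothed overlap when the form `b` is rotated by `exp (s K)`; the
integrand of the derivative is integrable. -/
lemma integrable_and_hasDerivAt_overlap_exp {n : ℕ} (m : ℕ) (ν : Measure (EuclideanSpace ℝ (Fin n)))
    [IsFiniteMeasure ν] {a b : Fin n → ℝ} (ha : ∀ i, 0 < a i) (hb : ∀ i, 0 < b i)
    (U : Matrix (Fin n) (Fin n) ℝ) {K : Matrix (Fin n) (Fin n) ℝ} {i : Fin n} {c : Fin n → ℝ}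
    (hK : ∀ x : EuclideanSpace ℝ (Fin n), ∑ p, b p * (x p * matAct K x p) = x i * ∑ j, c j * x j) :
    Integrable (fun x : EuclideanSpace ℝ (Fin n) => smoothStep m (diagForm a (matAct U x)) *
        (-(diagForm b x ^ (2 * m) * smoothStep m (diagForm b x)) *
          (2 * (x i * ∑ j, c j * x j)))) ν ∧
    HasDerivAt (fun s : ℝ => ∫ x, smoothStep m (diagForm a (matAct U x)) *
        smoothStep m (diagForm b (matAct (NormedSpace.exp (s • K)) x)) ∂ν)
      (∫ x, smoothStep m (diagForm a (matAct U x)) *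
        (-(diagForm b x ^ (2 * m) * smoothStep m (diagForm b x)) *
          (2 * (x i * ∑ j, c j * x j))) ∂ν) 0 := by
  obtain ⟨C, hC⟩ := exists_abs_le_mul_diagForm hb c i
  have hcont : Continuous fun x : EuclideanSpace ℝ (Fin n) =>
      smoothStep m (diagForm a (matAct U x)) *
        (-(diagForm b x ^ (2 * m) * smoothStep m (diagForm b x)) *
          (2 * (x i * ∑ j, c j * x j))) := by
    have h1 := (continuous_smoothStep m).comp ((continuous_diagForm a).comp (continuous_matAct U))
    have h2 := (continuous_smoothStep m).comp (continuous_diagForm b)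
    have h3 := continuous_diagForm b
    simp only [Function.comp_def] at h1 h2
    fun_prop
  have hz : ∀ x : EuclideanSpace ℝ (Fin n),
      matAct (NormedSpace.exp ((0 : ℝ) • K)) x = x := fun x => by simp [matAct_one]
  have h := hasDerivAt_integral_of_dominated_loc_of_deriv_le (μ := ν) (x₀ := (0 : ℝ))
    (F := fun s x => smoothStep m (diagForm a (matAct U x)) *
        smoothStep m (diagForm b (matAct (NormedSpace.exp (s • K)) x)))
    (F' := fun s x => smoothStep m (diagForm a (matAct U x)) *
      (-(diagForm b (matAct (NormedSpace.exp (s • K)) x) ^ (2 * m) *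
          smoothStep m (diagForm b (matAct (NormedSpace.exp (s • K)) x))) *
        (2 * ∑ p, b p * (matAct (NormedSpace.exp (s • K)) x p *
          matAct K (matAct (NormedSpace.exp (s • K)) x) p))))
    (bound := fun _ => 2 * |C| * (2 * m + 1)) (s := Set.univ) univ_mem
    (Eventually.of_forall fun s =>
      (continuous_overlap_integrand m a b U _).aestronglyMeasurable) ?_ ?_ ?_
    (integrable_const _) ?_
  · simpa only [hz, hK] using h
  · simpa only [hz] using integrable_overlap_integrand m ν ha hb U
  · simp only [hz, hK]
    exact hcont.aestronglyMeasurable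
  · refine Eventually.of_forall fun x s _ => ?_
    rw [hK]
    generalize matAct (NormedSpace.exp (s • K)) x = z
    have h1 := smoothStep_le_one m (diagForm_nonneg ha (matAct U x))
    have h2 := (smoothStep_pos m (diagForm a (matAct U x))).le
    have h3 := diagForm_nonneg hb z
    have h4 : 0 ≤ diagForm b z ^ (2 * m) * smoothStep m (diagForm b z) :=
      mul_nonneg (pow_nonneg h3 _) (smoothStep_pos _ _).le
    have h5 : |z i * ∑ j, c j * z j| ≤ |C| * diagForm b z :=
      (hC z).trans (mul_le_mul_of_nonneg_right (le_abs_self C) h3)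
    rw [norm_mul, norm_mul, norm_neg, norm_mul (2 : ℝ), Real.norm_of_nonneg h2,
      Real.norm_of_nonneg h4, Real.norm_of_nonneg (zero_le_two), Real.norm_eq_abs]
    calc _ ≤ 1 * (diagForm b z ^ (2 * m) * smoothStep m (diagForm b z) *
            (2 * (|C| * diagForm b z))) := by gcongr
      _ = 2 * |C| * (diagForm b z * (diagForm b z ^ (2 * m) * smoothStep m (diagForm b z))) := by
          ring
      _ ≤ _ := by
          gcongr
          exact mul_pow_mul_smoothStep_le m
  · exact Eventually.of_forall fun x s _ =>
      ((hasDerivAt_smoothStep m _).comp s (hasDerivAt_diagForm_exp b K x s)).const_mul _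

/-! ### The first-order condition at a minimum -/

/-- At a rotation minimising the smoothed overlap, the two quadratic forms have common axes. -/
lemma conj_apply_eq_zero_of_isMin {n : ℕ} (m : ℕ) {ν : Measure (EuclideanSpace ℝ (Fin n))}
    [IsFiniteMeasure ν] [ν.IsOpenPosMeasure] (hν : IsRotationInvariant ν) {a b : Fin n → ℝ}
    (ha : ∀ i, 0 < a i) (hb : ∀ i, 0 < b i) (hbinj : Function.Injective b)
    {U : Matrix (Fin n) (Fin n) ℝ} (hU : U ∈ orthogonalGroup (Fin n) ℝ)
    (hmin : ∀ V ∈ orthogonalGroup (Fin n) ℝ, overlap m ν a b U ≤ overlap m ν a b V)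
    {i j : Fin n} (hij : j ≠ i) : (Uᵀ * diagonal a * U) i j = 0 := by
  by_contra hne
  set c : Fin n → ℝ := fun j => if j = i then 0 else (Uᵀ * diagonal a * U) i j with hc
  set R : Matrix (Fin n) (Fin n) ℝ := diagonal fun j => if j = i then (-1 : ℝ) else 1 with hR
  obtain ⟨K, hKskew, hK⟩ := exists_skew_bilin_eq hbinj (c := c) (i := i) (by simp [hc])
  set y : EuclideanSpace ℝ (Fin n) → ℝ := fun x => x i * ∑ j, c j * x j with hy
  set G : EuclideanSpace ℝ (Fin n) → ℝ := fun x => smoothStep m (diagForm a (matAct U x)) *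
    (-(diagForm b x ^ (2 * m) * smoothStep m (diagForm b x)) * (2 * y x)) with hG
  have hGcont : Continuous G := by
    have h1 := (continuous_smoothStep m).comp ((continuous_diagForm a).comp (continuous_matAct U))
    have h2 := (continuous_smoothStep m).comp (continuous_diagForm b)
    have h3 := continuous_diagForm b
    simp only [Function.comp_def] at h1 h2
    fun_prop
  -- Rotation invariance moves the factor `exp (s K)ᵀ` from `U` to the form `b`.
  have hcurve : ∀ s : ℝ, overlap m ν a b (U * NormedSpace.exp (s • K)ᵀ) =
      ∫ x, smoothStep m (diagForm a (matAct U x)) *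
        smoothStep m (diagForm b (matAct (NormedSpace.exp (s • K)) x)) ∂ν := by
    intro s
    have hE := exp_smul_mem_orthogonalGroup hKskew s
    have := hν.integral_comp hE (continuous_overlap_integrand_id m a b
      (U * NormedSpace.exp (s • K)ᵀ))
    rw [overlap, ← this]
    simp only [matAct_mul, exp_transpose, matAct_transpose_matAct hE]
  obtain ⟨hGint, hderiv⟩ : Integrable G ν ∧ _ :=
    integrable_and_hasDerivAt_overlap_exp m ν ha hb U hK
  have hint : ∫ x, G x ∂ν = 0 := by
    refine IsLocalMin.hasDerivAt_eq_zero (Eventually.of_forall fun s => ?_)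
      hderiv
    simp only [← hcurve]
    have h0 : U * NormedSpace.exp ((0 : ℝ) • K)ᵀ = U := by simp
    rw [h0]
    refine hmin _ (mul_mem hU ?_)
    rw [exp_transpose]
    exact transpose_mem_orthogonalGroup (exp_smul_mem_orthogonalGroup hKskew s)
  have hRO : R ∈ orthogonalGroup (Fin n) ℝ := diagonal_sign_mem_orthogonalGroup i
  have hyR : ∀ x, y (matAct R x) = -y x := by
    intro x
    have hRx : ∀ j, matAct R x j = (if j = i then (-1 : ℝ) else 1) * x j := fun j => by
      rw [hR]
      exact mulVec_diagonal _ x.ofLp j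
    simp only [hy, hRx, if_true]
    have : ∀ j, c j * ((if j = i then (-1 : ℝ) else 1) * x j) = c j * x j := by
      intro j
      by_cases h : j = i <;> simp [hc, h]
    simp_rw [this]
    ring
  have hdiff : ∀ x, diagForm a (matAct U x) - diagForm a (matAct U (matAct R x)) = 4 * y x :=
    fun x => diagForm_matAct_sub_diagForm_matAct_sign a U i x
  have hsum : ∀ x, G x + G (matAct R x) =
      diagForm b x ^ (2 * m) * smoothStep m (diagForm b x) * 2 *
        (y x * (smoothStep m (diagForm a (matAct U (matAct R x))) -
          smoothStep m (diagForm a (matAct U x)))) := by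
    intro x
    have hbR : diagForm b (matAct R x) = diagForm b x := diagForm_matAct_sign b i x
    simp only [hG, hyR, hbR]
    ring
  -- The second factor has the sign of `y x`, since `smoothStep m` is strictly decreasing.
  have hpos : ∀ x, y x ≠ 0 → 0 < y x * (smoothStep m (diagForm a (matAct U (matAct R x))) -
      smoothStep m (diagForm a (matAct U x))) := by
    intro x hx
    rcases lt_or_gt_of_ne hx with h | h
    · exact mul_pos_of_neg_of_neg h (sub_neg.2 (strictAnti_smoothStep m (by linarith [hdiff x])))
    · exact mul_pos h (sub_pos.2 (strictAnti_smoothStep m (by linarith [hdiff x])))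
  have hnonneg : ∀ x, 0 ≤ G x + G (matAct R x) := by
    intro x
    rw [hsum]
    refine mul_nonneg (mul_nonneg (mul_nonneg (pow_nonneg (diagForm_nonneg hb x) _)
      (smoothStep_pos _ _).le) zero_le_two) ?_
    by_cases hx : y x = 0
    · simp [hx]
    · exact (hpos x hx).le
  have hcontsum : Continuous fun x => G x + G (matAct R x) :=
    hGcont.add (hGcont.comp (continuous_matAct R))
  have hGRint : Integrable (fun x => G (matAct R x)) ν := by
    have h : Integrable G (ν.map (matAct R)) := by rwa [hν R hRO]
    exact h.comp_measurable (continuous_matAct R).measurable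
  have hzero : ∫ x, (G x + G (matAct R x)) ∂ν = 0 := by
    rw [integral_add hGint hGRint, hν.integral_comp hRO hGcont, hint, add_zero]
  have hae := (integral_eq_zero_iff_of_nonneg hnonneg (hGint.add hGRint)).1 hzero
  have hall : (fun x => G x + G (matAct R x)) = 0 :=
    (hcontsum.ae_eq_iff_eq ν continuous_zero).1 hae
  set x₀ : EuclideanSpace ℝ (Fin n) := EuclideanSpace.single i 1 + EuclideanSpace.single j 1
    with hx₀
  have hy₀ : y x₀ = (Uᵀ * diagonal a * U) i j := by
    rw [hy]
    simp only
    rw [Finset.sum_eq_single j]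
    · simp [hx₀, hc, hij, hij.symm]
    · intro k _ hk
      by_cases h : k = i <;> simp [hx₀, hc, h, hk]
    · simp
  have hb₀ : 0 < diagForm b x₀ := by
    refine lt_of_lt_of_le ?_ (mul_sq_le_diagForm hb x₀ i)
    simp [hx₀, hij.symm, hb i]
  have h := congrFun hall x₀
  simp only [hsum, Pi.zero_apply] at h
  exact absurd h (mul_pos (mul_pos (mul_pos (pow_pos hb₀ _) (smoothStep_pos _ _)) two_pos)
    (hpos x₀ (by rwa [hy₀]))).ne'

/-! ### Minimisers of the smoothed overlap -/

lemma diagForm_matAct_of_conj_eq_diagonal {n : ℕ} {a d : Fin n → ℝ} {U : Matrix (Fin n) (Fin n) ℝ}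
    (h : Uᵀ * diagonal a * U = diagonal d) (x : EuclideanSpace ℝ (Fin n)) :
    diagForm a (matAct U x) = diagForm d x := by
  have hdot : ∀ (c : Fin n → ℝ) (z : Fin n → ℝ), ∑ i, c i * z i ^ 2 = z ⬝ᵥ (diagonal c *ᵥ z) := by
    intro c z
    simp only [dotProduct, mulVec_diagonal]
    exact Finset.sum_congr rfl fun i _ => by ring
  have h1 : diagForm a (matAct U x) = (U *ᵥ x.ofLp) ⬝ᵥ (diagonal a *ᵥ (U *ᵥ x.ofLp)) := hdot a _
  have h2 : diagForm d x = x.ofLp ⬝ᵥ (diagonal d *ᵥ x.ofLp) := hdot d _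
  rw [h1, h2, ← h, ← mulVec_mulVec, ← mulVec_mulVec, dotProduct_mulVec x.ofLp Uᵀ, vecMul_transpose]

/-- A rotation under which the form `diagForm a` becomes diagonal acts on it as a permutation
matrix. -/
lemma exists_rowPerm_diagForm_eq {n : ℕ} {a : Fin n → ℝ} {U : Matrix (Fin n) (Fin n) ℝ}
    (hU : U ∈ orthogonalGroup (Fin n) ℝ)
    (h : ∀ i j, j ≠ i → (Uᵀ * diagonal a * U) i j = 0) :
    ∃ σ : Equiv.Perm (Fin n), ∀ x : EuclideanSpace ℝ (Fin n),
      diagForm a (matAct (rowPerm σ) x) = diagForm a (matAct U x) := by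
  have hd : Uᵀ * diagonal a * U = diagonal fun i => (Uᵀ * diagonal a * U) i i := by
    ext i j
    rcases eq_or_ne i j with rfl | hij
    · rw [diagonal_apply_eq]
    · rw [diagonal_apply_ne _ hij, h i j hij.symm]
  obtain ⟨σ, hσ⟩ := exists_perm_of_conj_diagonal hU hd
  refine ⟨σ⁻¹, fun x => ?_⟩
  rw [diagForm_matAct_of_conj_eq_diagonal hd, diagForm, diagForm, ← Equiv.sum_comp σ]
  exact Finset.sum_congr rfl fun i _ => by rw [hσ, matAct_rowPerm_apply]; simp

lemma exists_rowPerm_overlap_le_of_injective {n : ℕ} (m : ℕ)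
    {ν : Measure (EuclideanSpace ℝ (Fin n))} [IsFiniteMeasure ν] [ν.IsOpenPosMeasure]
    (hν : IsRotationInvariant ν) {a b : Fin n → ℝ} (ha : ∀ i, 0 < a i) (hb : ∀ i, 0 < b i)
    (hbinj : Function.Injective b) :
    ∃ σ : Equiv.Perm (Fin n), ∀ U ∈ orthogonalGroup (Fin n) ℝ,
      overlap m ν a b (rowPerm σ) ≤ overlap m ν a b U := by
  obtain ⟨U, hU, hmin⟩ := (isCompact_orthogonalGroup n).exists_isMinOn ⟨1, one_mem _⟩
    (continuous_overlap m ν ha hb).continuousOn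
  obtain ⟨σ, hσ⟩ := exists_rowPerm_diagForm_eq hU fun i j hij =>
    conj_apply_eq_zero_of_isMin m hν ha hb hbinj hU (fun V hV => hmin hV) hij
  refine ⟨σ, fun V hV => le_trans (le_of_eq ?_) (hmin hV)⟩
  simp only [overlap, hσ]

/-- The distinctness of the entries of `b` is removed by perturbing them. -/
lemma exists_rowPerm_overlap_le_of_isOpenPos {n : ℕ} (m : ℕ)
    {ν : Measure (EuclideanSpace ℝ (Fin n))} [IsFiniteMeasure ν] [ν.IsOpenPosMeasure]
    (hν : IsRotationInvariant ν) {a b : Fin n → ℝ} (ha : ∀ i, 0 < a i) (hb : ∀ i, 0 < b i) :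
    ∃ σ : Equiv.Perm (Fin n), ∀ U ∈ orthogonalGroup (Fin n) ℝ,
      overlap m ν a b (rowPerm σ) ≤ overlap m ν a b U := by
  -- The entries `b i + t * i` are distinct for all small `t > 0`.
  have hpos : ∀ t : ℝ, 0 < t → ∀ i : Fin n, 0 < b i + t * (i : ℕ) := fun t ht i => by
    have := hb i
    positivity
  have hcont : ∀ i : Fin n, Tendsto (fun t : ℝ => b i + t * (i : ℕ)) (𝓝[>] 0) (𝓝 (b i)) := by
    intro i
    have : Continuous fun t : ℝ => b i + t * (i : ℕ) := by fun_prop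
    simpa using (this.tendsto 0).mono_left nhdsWithin_le_nhds
  have hinj : ∀ᶠ t : ℝ in 𝓝[>] 0, Function.Injective fun i : Fin n => b i + t * (i : ℕ) := by
    have h : ∀ᶠ t : ℝ in 𝓝[>] 0, ∀ i j : Fin n, i ≠ j → b i + t * (i : ℕ) ≠ b j + t * (j : ℕ) := by
      refine eventually_all.2 fun i => eventually_all.2 fun j => ?_
      by_cases hb' : b i = b j
      · filter_upwards [self_mem_nhdsWithin] with t ht hij h
        rw [hb', add_right_inj, mul_right_inj' (ne_of_gt ht), Nat.cast_inj] at h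
        exact hij (Fin.ext h)
      · filter_upwards [((hcont i).sub (hcont j)).eventually_ne (sub_ne_zero.2 hb')] with t ht _
        exact sub_ne_zero.1 ht
    filter_upwards [h] with t ht i j hij
    by_contra hne
    exact ht i j hne hij
  refine exists_le_of_tendsto (l := 𝓝[>] (0 : ℝ)) (p := rowPerm)
    (S := (orthogonalGroup (Fin n) ℝ : Set (Matrix (Fin n) (Fin n) ℝ)))
    (F := fun t => overlap m ν a fun i => b i + t * (i : ℕ)) ?_ fun U => ?_
  · filter_upwards [hinj, self_mem_nhdsWithin] with t ht htpos
    exact exists_rowPerm_overlap_le_of_injective m hν ha (hpos t htpos) ht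
  · refine tendsto_integral_filter_of_dominated_convergence (fun _ => 1)
      (Eventually.of_forall fun t =>
        (continuous_overlap_integrand_id m a _ U).aestronglyMeasurable) ?_ (integrable_const _)
      (Eventually.of_forall fun x => ?_)
    · filter_upwards [self_mem_nhdsWithin] with t ht
      exact Eventually.of_forall fun x => norm_smoothStep_mul_le m ha (hpos t ht) _ _
    · refine Tendsto.const_mul _ (((continuous_smoothStep m).tendsto _).comp ?_)
      exact tendsto_finsetSum _ fun i _ => (hcont i).mul_const _

lemma isRotationInvariant_stdGaussian (n : ℕ) :
    IsRotationInvariant (ProbabilityTheory.stdGaussian (EuclideanSpace ℝ (Fin n))) := by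
  intro U hU
  have hnorm : ∀ x : EuclideanSpace ℝ (Fin n), ‖matAct U x‖ = ‖x‖ := by
    intro x
    have h := diagForm_matAct_of_conj_eq_diagonal (a := fun _ => 1) (d := fun _ => 1) (U := U)
      (by rw [diagonal_one, Matrix.mul_one, (mem_orthogonalGroup_iff' _ _).1 hU]) x
    simp only [diagForm, one_mul] at h
    rw [EuclideanSpace.norm_eq, EuclideanSpace.norm_eq]
    simp only [Real.norm_eq_abs, sq_abs, h]
  let L : EuclideanSpace ℝ (Fin n) ≃ₗᵢ[ℝ] EuclideanSpace ℝ (Fin n) :=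
    { toFun := matAct U
      invFun := matAct Uᵀ
      left_inv := matAct_transpose_matAct hU
      right_inv := matAct_matAct_transpose hU
      map_add' := fun x y => by simp [matAct, mulVec_add]
      map_smul' := fun c x => by simp [matAct, mulVec_smul]
      norm_map' := hnorm }
  exact ProbabilityTheory.stdGaussian_map L

instance isOpenPosMeasure_stdGaussian (n : ℕ) :
    (ProbabilityTheory.stdGaussian (EuclideanSpace ℝ (Fin n))).IsOpenPosMeasure := by
  have : (ProbabilityTheory.gaussianReal 0 1).IsOpenPosMeasure :=
    (ProbabilityTheory.gaussianReal_absolutelyContinuous' 0 one_ne_zero).isOpenPosMeasure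
  rw [← ProbabilityTheory.map_pi_eq_stdGaussian]
  exact Continuous.isOpenPosMeasure_map (by fun_prop) (WithLp.toLp_surjective 2)

/-- The full support of `ν` is removed by adding small multiples of the standard Gaussian. -/
lemma exists_rowPerm_overlap_le {n : ℕ} (m : ℕ)
    {ν : Measure (EuclideanSpace ℝ (Fin n))} [IsFiniteMeasure ν]
    (hν : IsRotationInvariant ν) {a b : Fin n → ℝ} (ha : ∀ i, 0 < a i) (hb : ∀ i, 0 < b i) :
    ∃ σ : Equiv.Perm (Fin n), ∀ U ∈ orthogonalGroup (Fin n) ℝ,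
      overlap m ν a b (rowPerm σ) ≤ overlap m ν a b U := by
  set γ := ProbabilityTheory.stdGaussian (EuclideanSpace ℝ (Fin n)) with hγ
  set ε : ℕ → NNReal := fun k => 1 / ((k : NNReal) + 1) with hε
  refine exists_le_of_tendsto (l := atTop) (p := rowPerm)
    (S := (orthogonalGroup (Fin n) ℝ : Set (Matrix (Fin n) (Fin n) ℝ)))
    (F := fun k => overlap m (ν + ε k • γ) a b) (Eventually.of_forall fun k => ?_) fun U => ?_
  · have hk : ε k ≠ 0 := by simp only [hε]; positivity
    have : (ν + ε k • γ).IsOpenPosMeasure := ⟨fun V hV hne h => by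
      rw [Measure.add_apply, add_eq_zero, Measure.smul_apply, smul_eq_zero] at h
      exact hV.measure_ne_zero γ hne (h.2.resolve_left hk)⟩
    refine exists_rowPerm_overlap_le_of_isOpenPos m (fun U hU => ?_) ha hb
    rw [Measure.map_add _ _ (continuous_matAct U).measurable, Measure.map_smul, hν U hU,
      isRotationInvariant_stdGaussian n U hU]
  · have h : ∀ k, overlap m (ν + ε k • γ) a b U =
        overlap m ν a b U + (ε k : ℝ) * overlap m γ a b U := by
      intro k
      rw [overlap, integral_add_measure (integrable_overlap_integrand m ν ha hb U)
        (integrable_overlap_integrand m _ ha hb U), integral_smul_nnreal_measure]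
      rfl
    simp only [h]
    have h0 : Tendsto (fun k => (ε k : ℝ)) atTop (𝓝 0) := by
      simpa [hε] using tendsto_one_div_add_atTop_nhds_zero_nat (𝕜 := ℝ)
    simpa using (h0.mul_const (overlap m γ a b U)).const_add (overlap m ν a b U)

/-! ### Measures of intersections -/

lemma exists_rowPerm_measure_le_of_isFiniteMeasure {n : ℕ}
    {ν : Measure (EuclideanSpace ℝ (Fin n))} [IsFiniteMeasure ν]
    (hν : IsRotationInvariant ν) {a b : Fin n → ℝ} (ha : ∀ i, 0 < a i) (hb : ∀ i, 0 < b i) :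
    ∃ σ : Equiv.Perm (Fin n), ∀ U ∈ orthogonalGroup (Fin n) ℝ,
      ν {x | diagForm a (matAct (rowPerm σ) x) ≤ 1 ∧ diagForm b x ≤ 1} ≤
        ν {x | diagForm a (matAct U x) ≤ 1 ∧ diagForm b x ≤ 1} := by
  have h : ∃ σ : Equiv.Perm (Fin n), ∀ U ∈ orthogonalGroup (Fin n) ℝ,
      ν.real {x | diagForm a (matAct (rowPerm σ) x) ≤ 1 ∧ diagForm b x ≤ 1} ≤
        ν.real {x | diagForm a (matAct U x) ≤ 1 ∧ diagForm b x ≤ 1} := by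
    refine exists_le_of_tendsto (l := atTop) (p := rowPerm)
      (S := (orthogonalGroup (Fin n) ℝ : Set (Matrix (Fin n) (Fin n) ℝ)))
      (F := fun m => overlap m ν a b)
      (G := fun U => ν.real {x | diagForm a (matAct U x) ≤ 1 ∧ diagForm b x ≤ 1})
      (Eventually.of_forall fun m => exists_rowPerm_overlap_le m hν ha hb) fun U => ?_
    have hmeas : MeasurableSet {x | diagForm a (matAct U x) ≤ 1 ∧ diagForm b x ≤ 1} :=
      ((isClosed_le ((continuous_diagForm a).comp (continuous_matAct U)) continuous_const).inter
        (isClosed_le (continuous_diagForm b) continuous_const)).measurableSet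
    rw [← integral_indicator_one hmeas]
    refine tendsto_integral_of_dominated_convergence (fun _ => 1)
      (fun m => (continuous_overlap_integrand_id m a b U).aestronglyMeasurable)
      (integrable_const _)
      (fun m => Eventually.of_forall fun x => norm_smoothStep_mul_le m ha hb _ _)
      (Eventually.of_forall fun x => ?_)
    have hx : Set.indicator {x | diagForm a (matAct U x) ≤ 1 ∧ diagForm b x ≤ 1} 
        (1 : EuclideanSpace ℝ (Fin n) → ℝ) x =
        Set.indicator (Set.Iic 1) 1 (diagForm a (matAct U x)) *
          Set.indicator (Set.Iic 1) 1 (diagForm b x) := by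
      by_cases h1 : diagForm a (matAct U x) ≤ 1 <;> by_cases h2 : diagForm b x ≤ 1 <;>
        simp [h1, h2]
    rw [hx]
    exact (tendsto_smoothStep (diagForm_nonneg ha _)).mul
      (tendsto_smoothStep (diagForm_nonneg hb _))
  obtain ⟨σ, hσ⟩ := h
  exact ⟨σ, fun U hU => (ENNReal.toReal_le_toReal (measure_ne_top _ _) (measure_ne_top _ _)).1
    (hσ U hU)⟩

/-! ### From finite to s-finite measures -/

/-- An s-finite rotation-invariant measure is a countable sum of finite rotation-invariant measures:
average finite summands over the orthogonal group with respect to Haar measure. -/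
lemma IsRotationInvariant.exists_eq_sum {n : ℕ} {ν : Measure (EuclideanSpace ℝ (Fin n))} [SFinite ν]
    (hν : IsRotationInvariant ν) : ∃ η : ℕ → Measure (EuclideanSpace ℝ (Fin n)),
      (∀ k, IsFiniteMeasure (η k)) ∧ (∀ k, IsRotationInvariant (η k)) ∧ Measure.sum η = ν := by
  let O := orthogonalGroup (Fin n) ℝ
  have : SecondCountableTopology (Matrix (Fin n) (Fin n) ℝ) :=
    inferInstanceAs (SecondCountableTopology (Fin n → Fin n → ℝ))
  have : CompactSpace O := isCompact_iff_compactSpace.1 (isCompact_orthogonalGroup n)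
  have : IsTopologicalGroup O :=
    inferInstanceAs (IsTopologicalGroup (unitary (Matrix (Fin n) (Fin n) ℝ)))
  let _ : MeasurableSpace O := borel O
  have : BorelSpace O := ⟨rfl⟩
  let h : Measure O := Measure.haarMeasure ⊤
  have hprob : IsProbabilityMeasure h := ⟨Measure.haarMeasure_self⟩
  have hact : Continuous fun p : O × EuclideanSpace ℝ (Fin n) => matAct (p.1 : Matrix _ _ ℝ) p.2 :=
    continuous_matAct_uncurry.comp (continuous_subtype_val.prodMap continuous_id)
  let avg : Measure (EuclideanSpace ℝ (Fin n)) → Measure (EuclideanSpace ℝ (Fin n)) :=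
    fun μ => (h.prod μ).map fun p => matAct (p.1 : Matrix _ _ ℝ) p.2
  have havg : ∀ (μ : Measure (EuclideanSpace ℝ (Fin n))) [SFinite μ] (s : Set _),
      MeasurableSet s → avg μ s = ∫⁻ g : O, μ (matAct (g : Matrix _ _ ℝ) ⁻¹' s) ∂h := by
    intro μ _ s hs
    rw [Measure.map_apply hact.measurable hs, Measure.prod_apply (hact.measurable hs)]
    rfl
  refine ⟨fun k => avg (sfiniteSeq ν k), fun k => ?_, fun k U hU => ?_, ?_⟩
  · exact inferInstanceAs (IsFiniteMeasure (Measure.map _ _))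
  · ext s hs
    rw [Measure.map_apply (continuous_matAct U).measurable hs, havg _ _ hs,
      havg _ _ ((continuous_matAct U).measurable hs),
      ← lintegral_mul_left_eq_self (μ := h)
        (fun g : O => sfiniteSeq ν k (matAct (g : Matrix _ _ ℝ) ⁻¹' s)) ⟨U, hU⟩]
    refine lintegral_congr fun g => congrArg _ ?_
    ext x
    simp only [Set.mem_preimage, Submonoid.coe_mul, matAct_mul]
  · ext s hs
    rw [Measure.sum_apply _ hs]
    simp only [havg _ s hs]
    rw [← lintegral_tsum fun k => ?_]
    · have : ∀ g : O, ∑' k, sfiniteSeq ν k (matAct (g : Matrix _ _ ℝ) ⁻¹' s) = ν s := by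
        intro g
        have hg := (continuous_matAct (g : Matrix (Fin n) (Fin n) ℝ)).measurable
        rw [← Measure.sum_apply _ (hg hs), sum_sfiniteSeq, ← Measure.map_apply hg hs, hν g g.2]
      simp [this]
    · exact (measurable_measure_prodMk_left (hact.measurable hs)).aemeasurable

lemma exists_rowPerm_measure_le {n : ℕ} {ν : Measure (EuclideanSpace ℝ (Fin n))} [SFinite ν]
    (hν : IsRotationInvariant ν) {a b : Fin n → ℝ} (ha : ∀ i, 0 < a i) (hb : ∀ i, 0 < b i) :
    ∃ σ : Equiv.Perm (Fin n), ∀ U ∈ orthogonalGroup (Fin n) ℝ,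
      ν {x | diagForm a (matAct (rowPerm σ) x) ≤ 1 ∧ diagForm b x ≤ 1} ≤
        ν {x | diagForm a (matAct U x) ≤ 1 ∧ diagForm b x ≤ 1} := by
  obtain ⟨η, hfin, hinv, rfl⟩ := hν.exists_eq_sum
  have hmeas : ∀ U : Matrix (Fin n) (Fin n) ℝ,
      MeasurableSet {x | diagForm a (matAct U x) ≤ 1 ∧ diagForm b x ≤ 1} := fun U =>
    ((isClosed_le ((continuous_diagForm a).comp (continuous_matAct U)) continuous_const).inter
      (isClosed_le (continuous_diagForm b) continuous_const)).measurableSet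
  refine exists_le_of_tendsto (l := atTop) (p := rowPerm)
    (S := (orthogonalGroup (Fin n) ℝ : Set (Matrix (Fin n) (Fin n) ℝ)))
    (F := fun N U => (∑ k ∈ Finset.range N, η k)
      {x | diagForm a (matAct U x) ≤ 1 ∧ diagForm b x ≤ 1})
    (G := fun U => Measure.sum η {x | diagForm a (matAct U x) ≤ 1 ∧ diagForm b x ≤ 1})
    (Eventually.of_forall fun N => ?_) fun U => ?_
  · refine exists_rowPerm_measure_le_of_isFiniteMeasure (fun U hU => ?_) ha hb
    rw [← Measure.mapₗ_apply_of_measurable (continuous_matAct U).measurable, map_sum]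
    refine Finset.sum_congr rfl fun k _ => ?_
    rw [Measure.mapₗ_apply_of_measurable (continuous_matAct U).measurable, hinv k U hU]
  · simp only [Measure.sum_apply _ (hmeas U), Measure.finsetSum_apply]
    exact ENNReal.tendsto_nat_tsum _

lemma matAct_image_eq_preimage {n : ℕ} {U : Matrix (Fin n) (Fin n) ℝ}
    (hU : U ∈ orthogonalGroup (Fin n) ℝ) (s : Set (EuclideanSpace ℝ (Fin n))) :
    matAct U '' s = matAct Uᵀ ⁻¹' s :=
  congrFun (Set.image_eq_preimage_of_inverse (matAct_transpose_matAct hU)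
    (matAct_matAct_transpose hU)) s

lemma mem_stdEllipsoid_iff {n : ℕ} (r : Fin n → ℝ) (x : EuclideanSpace ℝ (Fin n)) :
    x ∈ stdEllipsoid r ↔ diagForm (fun i => (r i ^ 2)⁻¹) x ≤ 1 := by
  simp [stdEllipsoid, diagForm, div_eq_inv_mul]

lemma transpose_rowPerm {n : ℕ} (σ : Equiv.Perm (Fin n)) : (rowPerm σ)ᵀ = rowPerm σ⁻¹ := by
  ext i j
  simp only [rowPerm, transpose_apply, submatrix_apply, one_apply, id, Equiv.Perm.inv_eq_iff_eq]
  exact if_congr eq_comm rfl rfl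

theorem theorem10 (n : ℕ) (ν : Measure (EuclideanSpace ℝ (Fin n))) [SFinite ν]
    (hν : IsRotationInvariant ν) (r ρ : Fin n → ℝ)
    (hr : ∀ i, 0 < r i) (hρ : ∀ i, 0 < ρ i) :
    ∃ σ : Equiv.Perm (Fin n),
      IsLeast {t : ENNReal | ∃ U ∈ Matrix.orthogonalGroup (Fin n) ℝ,
          t = ν (matAct U '' stdEllipsoid ρ ∩ stdEllipsoid r)}
        (ν (matAct (rowPerm σ) '' stdEllipsoid ρ ∩ stdEllipsoid r)) ∧
      matAct (rowPerm σ) '' stdEllipsoid ρ = stdEllipsoid (fun i => ρ (σ i)) := by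
  have hset : ∀ U ∈ orthogonalGroup (Fin n) ℝ,
      matAct U '' stdEllipsoid ρ ∩ stdEllipsoid r =
        {x | diagForm (fun i => (ρ i ^ 2)⁻¹) (matAct Uᵀ x) ≤ 1 ∧
          diagForm (fun i => (r i ^ 2)⁻¹) x ≤ 1} := by
    intro U hU
    rw [matAct_image_eq_preimage hU]
    ext x
    simp only [Set.mem_inter_iff, Set.mem_preimage, mem_stdEllipsoid_iff, Set.mem_ofPred_eq]
  obtain ⟨τ, hτ⟩ := exists_rowPerm_measure_le hν
    (a := fun i => (ρ i ^ 2)⁻¹) (b := fun i => (r i ^ 2)⁻¹)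
    (fun i => inv_pos.2 (pow_pos (hρ i) 2)) (fun i => inv_pos.2 (pow_pos (hr i) 2))
  have hmem := rowPerm_mem_orthogonalGroup (n := n)
  refine ⟨τ⁻¹, ⟨⟨_, hmem _, rfl⟩, ?_⟩, ?_⟩
  · rintro _ ⟨U, hU, rfl⟩
    rw [hset _ (hmem _), hset U hU, transpose_rowPerm, inv_inv]
    exact hτ _ (transpose_mem_orthogonalGroup hU)
  · rw [matAct_image_eq_preimage (hmem _), transpose_rowPerm, inv_inv]
    ext x
    simp only [Set.mem_preimage, stdEllipsoid, Set.mem_ofPred_eq, matAct_rowPerm_apply]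
    rw [← Equiv.sum_comp τ fun i => x i ^ 2 / ρ (τ⁻¹ i) ^ 2]
    simp
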